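/- Throughout, manifolds are smooth and Hausdorff. Let $X$ be a Poisson manifold of dimension $n$ with Poisson tensor $\Theta$, and let $\mathcal G\rightrightarrows X$ be a local symplectic groupoid integrating $(X,\Theta)$, with symplectic form $\omega$. That is, $\mathcal G$ is a manifold of dimension $2n$ with source and target submersions $s,t:\mathcal G\to X$, a unit map $i_0:X\to\mathcal G$, an inversion diffeomorphism, and a smooth product $(\beta,\alpha)\mapsto\beta\circ\alpha$ defined on a set $\mathcal G_m$ that is relatively open in $\{(\beta,\alpha): s(\beta)=t(\alpha)\}$; products with units and with inverses are defined and satisfy the usual laws, and associativity holds whenever both sides are defined. The graph $\{(\beta\circ\alpha,\beta,\alpha)\}$ is Lagrangian in $\overline{\mathcal G}\times\mathcal G\times\mathcal G$, where $\overline{\mathcal G}=(\mathcal G,-\omega)$, and $s$ is a Poisson map. The Poisson bracket of a nondegenerate two-form $\Omega=\tfrac12\Omega_{ij}\,dz^i\wedge dz^j$ is $\{f,g\}=\partial_i f\,(\Omega^{-1})^{ij}\,\partial_j g$. Let $\Sigma$ be a bisection, i.e. a closed submanifold of $\mathcal G$ on which $s$ and $t$ restrict to diffeomorphisms onto $X$.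 Put $\Sigma_t=(t|_\Sigma)^{-1}$ and $F^t=\Sigma_t^*\omega$, a two-form on $X$. The right action of $\Sigma$ is $R_\Sigma(g)=g\circ\Sigma_t(s(g))$, defined on the open set $D_\Sigma=\{g:(g,\Sigma_t(s(g)))\in\mathcal G_m\}$. Let $(y^1,\dots,y^n,\pi_1,\dots,\pi_n)$ be local coordinates of cotangent type on an open set $W\subset\mathcal G$: the $y^j$ are the pullbacks by $s$ of local coordinates on $X$, a point of $W$ is a unit if and only if $\pi=0$ there, and $\omega=d\pi_\mu\wedge dQ^\mu$ on $W$ for some smooth functions $Q^\mu$ (so that $(Q,\pi)$ are Darboux coordinates). Then: 1. On $W\cap D_\Sigma$ the form $R_\Sigma^*\omega$ is nondegenerate and can be written $$R_\Sigma^*\omega=\tfrac12R_{lm}\,dy^l\wedge dy^m+\Gamma_l^m\left(d\pi_m\otimes dy^l-dy^l\otimes d\pi_m\right)+\tfrac12\,\Xi^{lm}\,d\pi_l\wedge d\pi_m ,$$ with $R$ and $\Xi$ antisymmetric and with $\Gamma$ invertible. 2. Every point of $W$ with $\pi=0$ lies in $D_\Sigma$. For such a point, with base point $y$, let $\widehat{\mathcal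 F}_{ab}(y)=\{\pi_a,\pi_b\}_A|_{\pi=0}(y)$, where $\{\cdot,\cdot\}_A$ is the Poisson bracket of $R_\Sigma^*\omega$; let $F^t$ be the matrix $F^t_{ab}(y)=F^t(\partial_a,\partial_b)(y)$; let $\Gamma$ be the matrix with entry $\Gamma_l^m$ in row $m$ and column $l$; and let $\overline\Gamma=\Gamma^{-1}$ and $\widehat\Xi=\overline\Gamma\,\Xi\,\overline\Gamma^{T}$, all evaluated at this point. Then the matrices $\mathbb I+\overline\Gamma^TF^t\,\overline\Gamma\,\Xi$ and $\mathbb I-\Gamma^T\widehat{\mathcal F}\,\Gamma\,\widehat\Xi$ are invertible, and $$\widehat{\mathcal F}=\left(\mathbb I+\overline\Gamma^TF^t\,\overline\Gamma\,\Xi\right)^{-1}\overline\Gamma^TF^t\,\overline\Gamma,\qquad F^t=\left(\mathbb I-\Gamma^T\widehat{\mathcal F}\,\Gamma\,\widehat\Xi\right)^{-1}\Gamma^T\widehat{\mathcal F}\,\Gamma .$$ -/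

import Mathlib

open scoped Manifold ContDiff Topology Matrix

noncomputable section

namespace PoissonGauge

/-! ### Two-forms on manifolds, symplectic structures, Lagrangian submanifolds -/

/-- A (not necessarily smooth) field of alternating bilinear forms on the tangent spaces of `M`.
The value of `Ω` at `x` on `u, v` is `Ω x ![u, v]`. -/
abbrev TwoForm {E H : Type*} [NormedAddCommGroup E] [NormedSpace ℝ E] [TopologicalSpace H]
    (I : ModelWithCorners ℝ E H) (M : Type*) [TopologicalSpace M] [ChartedSpace H M] :=
  ∀ x : M, TangentSpace I x [⋀^Fin 2]→L[ℝ] ℝ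

section Forms

variable {E H E' H' : Type*} [NormedAddCommGroup E] [NormedSpace ℝ E] [TopologicalSpace H]
  [NormedAddCommGroup E'] [NormedSpace ℝ E'] [TopologicalSpace H']

/-- The pullback `f^*Ω` of a two-form: `(f^*Ω)_x(u, v) = Ω_{f x}(df u, df v)`. -/
def pullback (I : ModelWithCorners ℝ E H) (J : ModelWithCorners ℝ E' H')
    {M N : Type*} [TopologicalSpace M] [ChartedSpace H M] [TopologicalSpace N]
    [ChartedSpace H' N] (f : M → N) (Ω : TwoForm J N) : TwoForm I M :=
  fun x => (Ω (f x)).compContinuousLinearMap (mfderiv I J f x)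

/-- The expression of a two-form in a chart `φ`, as a differential form on the model space. -/
def chartForm {M : Type*} [TopologicalSpace M] [ChartedSpace E M]
    (Ω : TwoForm 𝓘(ℝ, E) M) (φ : OpenPartialHomeomorph M E) : E → E [⋀^Fin 2]→L[ℝ] ℝ :=
  fun z => (pullback 𝓘(ℝ, E) 𝓘(ℝ, E) φ.symm Ω z).compContinuousLinearMap
    ((NormedSpace.fromTangentSpace (𝕜 := ℝ) z).symm : E →L[ℝ] TangentSpace 𝓘(ℝ, E) z)

/-- An alternating bilinear form whose left kernel is zero. -/
def Nondegenerate {V : Type*} [AddCommGroup V] [Module ℝ V] [TopologicalSpace V]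
    (B : V [⋀^Fin 2]→L[ℝ] ℝ) : Prop :=
  ∀ u : V, (∀ v : V, B ![u, v] = 0) → u = 0

/-- A symplectic form: a smooth, closed and nondegenerate two-form. -/
structure IsSymplectic {M : Type*} [TopologicalSpace M] [ChartedSpace E M]
    (Ω : TwoForm 𝓘(ℝ, E) M) : Prop where
  smooth : ∀ φ ∈ IsManifold.maximalAtlas 𝓘(ℝ, E) ∞ M, ContDiffOn ℝ ∞ (chartForm Ω φ) φ.target
  closed : ∀ φ ∈ IsManifold.maximalAtlas 𝓘(ℝ, E) ∞ M, ∀ z ∈ φ.target,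
    extDeriv (chartForm Ω φ) z = 0
  nondegenerate : ∀ x : M, Nondegenerate (Ω x)

/-- The vectors at `x` tangent to a subset `S` of a manifold: velocities at time `0` of smooth
curves in `S` that pass through `x` at time `0`. For an embedded submanifold this is its
tangent space. -/
def tangentSet (I : ModelWithCorners ℝ E H) {M : Type*} [TopologicalSpace M] [ChartedSpace H M]
    (S : Set M) (x : M) : Set (TangentSpace I x) :=
  {v | ∃ c : ℝ → M, ContMDiffAt 𝓘(ℝ, ℝ) I ∞ c 0 ∧ (∀ᶠ τ in 𝓝 (0 : ℝ), c τ ∈ S) ∧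
    tangentMap 𝓘(ℝ, ℝ) I c ⟨0, (NormedSpace.fromTangentSpace (𝕜 := ℝ) (0 : ℝ)).symm 1⟩ =
      (⟨x, v⟩ : TangentBundle I M)}

/-- `S` is Lagrangian for `Ω`: every tangent space of `S` equals its `Ω`-orthogonal. -/
def IsLagrangian (I : ModelWithCorners ℝ E H) {M : Type*} [TopologicalSpace M]
    [ChartedSpace H M] (Ω : TwoForm I M) (S : Set M) : Prop :=
  ∀ x ∈ S, ∀ v : TangentSpace I x,
    v ∈ tangentSet I S x ↔ ∀ w ∈ tangentSet I S x, Ω x ![v, w] = 0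

end Forms

/-! ### Poisson brackets -/

open Classical in
/-- The pairing of two covectors by the inverse of a nondegenerate form `B`: the number `α v`, for
the unique `v` with `B(w, v) = β w` for all `w`. In a basis this is `αᵀ Ω⁻¹ β`, where
`Ω i j = B(e i, e j)`; for `B = dp ∧ dx` it gives `{x, p} = 1`. -/
def inversePairing {V : Type*} [AddCommGroup V] [Module ℝ V] [TopologicalSpace V]
    (B : V [⋀^Fin 2]→L[ℝ] ℝ) (α β : V →L[ℝ] ℝ) : ℝ :=
  if h : ∃ v : V, ∀ w : V, B ![w, v] = β w then α h.choose else 0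

/-- The Poisson bracket `{f, g}` at `x` defined by a nondegenerate two-form `Ω`. -/
def formBracket {E H : Type*} [NormedAddCommGroup E] [NormedSpace ℝ E] [TopologicalSpace H]
    {I : ModelWithCorners ℝ E H} {M : Type*} [TopologicalSpace M] [ChartedSpace H M]
    (Ω : TwoForm I M) (f g : M → ℝ) (x : M) : ℝ :=
  inversePairing (Ω x) (mvfderiv I f x) (mvfderiv I g x)

/-- A Poisson tensor on a manifold: a smooth bivector field whose bracket
`{f, g} = Θ(df, dg)` satisfies the Jacobi identity. -/
structure PoissonTensor (E : Type*) [NormedAddCommGroup E] [NormedSpace ℝ E]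
    (X : Type*) [TopologicalSpace X] [ChartedSpace E X] where
  tensor : ∀ x : X, (TangentSpace 𝓘(ℝ, E) x →L[ℝ] ℝ) →ₗ[ℝ]
    (TangentSpace 𝓘(ℝ, E) x →L[ℝ] ℝ) →ₗ[ℝ] ℝ
  antisymm : ∀ x α β, tensor x α β = -tensor x β α
  smooth : ∀ f g : X → ℝ, ContMDiff 𝓘(ℝ, E) 𝓘(ℝ, ℝ) ∞ f → ContMDiff 𝓘(ℝ, E) 𝓘(ℝ, ℝ) ∞ g →
    ContMDiff 𝓘(ℝ, E) 𝓘(ℝ, ℝ) ∞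
      (fun x => tensor x (mvfderiv 𝓘(ℝ, E) f x) (mvfderiv 𝓘(ℝ, E) g x))
  jacobi : ∀ f g h : X → ℝ, ContMDiff 𝓘(ℝ, E) 𝓘(ℝ, ℝ) ∞ f →
    ContMDiff 𝓘(ℝ, E) 𝓘(ℝ, ℝ) ∞ g → ContMDiff 𝓘(ℝ, E) 𝓘(ℝ, ℝ) ∞ h →
    let bracket : (X → ℝ) → (X → ℝ) → X → ℝ :=
      fun a b x => tensor x (mvfderiv 𝓘(ℝ, E) a x) (mvfderiv 𝓘(ℝ, E) b x)
    ∀ x, bracket f (bracket g h) x + bracket g (bracket h f) x + bracket h (bracket f g) x = 0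

/-! ### Local symplectic groupoids -/

/-- The model space of an `n`-dimensional base manifold. -/
abbrev BaseModel (n : ℕ) := Fin n → ℝ

/-- The model space of a groupoid of dimension `2n` (positions and momenta). -/
abbrev PhaseModel (n : ℕ) := (Fin n → ℝ) × (Fin n → ℝ)

/-- A local Lie groupoid `G ⇉ X` over an `n`-dimensional base, `dim G = 2n`. The product
`mul β α` ("first `α`, then `β`") is meaningful for `(β, α) ∈ composable` only. -/
structure LocalLieGroupoid (n : ℕ) (G X : Type*) [TopologicalSpace G]
    [ChartedSpace (PhaseModel n) G] [TopologicalSpace X] [ChartedSpace (BaseModel n) X] where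
  src : G → X
  tgt : G → X
  src_smooth : ContMDiff 𝓘(ℝ, PhaseModel n) 𝓘(ℝ, BaseModel n) ∞ src
  tgt_smooth : ContMDiff 𝓘(ℝ, PhaseModel n) 𝓘(ℝ, BaseModel n) ∞ tgt
  src_submersion : ∀ g, Function.Surjective
    (mfderiv 𝓘(ℝ, PhaseModel n) 𝓘(ℝ, BaseModel n) src g)
  tgt_submersion : ∀ g, Function.Surjective
    (mfderiv 𝓘(ℝ, PhaseModel n) 𝓘(ℝ, BaseModel n) tgt g)
  /-- The inclusion of the units. -/
  unit : X → G
  unit_smooth : ContMDiff 𝓘(ℝ, BaseModel n) 𝓘(ℝ, PhaseModel n) ∞ unit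
  src_unit : ∀ x, src (unit x) = x
  tgt_unit : ∀ x, tgt (unit x) = x
  inv : Diffeomorph 𝓘(ℝ, PhaseModel n) 𝓘(ℝ, PhaseModel n) G G ∞
  /-- The domain of the multiplication, relatively open in the set of pairs `(β, α)` with
  `src β = tgt α`. -/
  composable : Set (G × G)
  composable_open : ∃ O : Set (G × G), IsOpen O ∧
    composable = O ∩ {q | src q.1 = tgt q.2}
  mul : G → G → G
  mul_smooth : ContMDiffOn (𝓘(ℝ, PhaseModel n).prod 𝓘(ℝ, PhaseModel n)) 𝓘(ℝ, PhaseModel n) ∞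
    (fun q : G × G => mul q.1 q.2) composable
  src_mul : ∀ β α, (β, α) ∈ composable → src (mul β α) = src α
  tgt_mul : ∀ β α, (β, α) ∈ composable → tgt (mul β α) = tgt β
  mul_unit : ∀ α, (α, unit (src α)) ∈ composable ∧ mul α (unit (src α)) = α
  unit_mul : ∀ α, (unit (tgt α), α) ∈ composable ∧ mul (unit (tgt α)) α = α
  mul_inv : ∀ α, (α, inv α) ∈ composable ∧ mul α (inv α) = unit (tgt α)
  inv_mul : ∀ α, (inv α, α) ∈ composable ∧ mul (inv α) α = unit (src α)
  /-- Associativity, whenever both sides are defined. -/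
  mul_assoc : ∀ γ β α, (β, α) ∈ composable → (γ, mul β α) ∈ composable →
    (γ, β) ∈ composable → (mul γ β, α) ∈ composable → mul γ (mul β α) = mul (mul γ β) α

/-- A local symplectic groupoid: a local Lie groupoid with a symplectic form `ω` such that the
graph `{(βα, β, α)}` of the multiplication is Lagrangian for the form
`-pr₁^*ω + pr₂^*ω + pr₃^*ω` on `G × G × G`. -/
structure LocalSymplecticGroupoid (n : ℕ) (G X : Type*) [TopologicalSpace G]
    [ChartedSpace (PhaseModel n) G] [TopologicalSpace X] [ChartedSpace (BaseModel n) X]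
    extends LocalLieGroupoid n G X where
  form : TwoForm 𝓘(ℝ, PhaseModel n) G
  symplectic : IsSymplectic form
  graph_lagrangian :
    IsLagrangian
      (𝓘(ℝ, PhaseModel n).prod (𝓘(ℝ, PhaseModel n).prod 𝓘(ℝ, PhaseModel n)))
      (M := G × G × G)
      (fun q => -pullback _ 𝓘(ℝ, PhaseModel n) (fun r : G × G × G => r.1) form q
        + pullback _ 𝓘(ℝ, PhaseModel n) (fun r : G × G × G => r.2.1) form q
        + pullback _ 𝓘(ℝ, PhaseModel n) (fun r : G × G × G => r.2.2) form q)
      {q | (q.2.1, q.2.2) ∈ composable ∧ q.1 = mul q.2.1 q.2.2}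

section Groupoid

variable {n : ℕ} {G X : Type*} [TopologicalSpace G] [ChartedSpace (PhaseModel n) G]
  [TopologicalSpace X] [ChartedSpace (BaseModel n) X]

/-- The local symplectic groupoid integrates `(X, Θ)`: the source map is a Poisson map from
`(G, ω⁻¹)` to `(X, Θ)`. -/
def LocalSymplecticGroupoid.Integrates (𝒢 : LocalSymplecticGroupoid n G X)
    (Θ : PoissonTensor (BaseModel n) X) : Prop :=
  ∀ (g : G) (α β : TangentSpace 𝓘(ℝ, BaseModel n) (𝒢.src g) →L[ℝ] ℝ),
    inversePairing (𝒢.form g)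
      (α ∘L mfderiv 𝓘(ℝ, PhaseModel n) 𝓘(ℝ, BaseModel n) 𝒢.src g)
      (β ∘L mfderiv 𝓘(ℝ, PhaseModel n) 𝓘(ℝ, BaseModel n) 𝒢.src g) = Θ.tensor (𝒢.src g) α β

/-- A bisection: a closed submanifold `carrier` on which `src` and `tgt` restrict to
diffeomorphisms onto `X`, with smooth inverses `secS = (src|_Σ)⁻¹` and `secT = (tgt|_Σ)⁻¹`. -/
structure Bisection (𝒢 : LocalSymplecticGroupoid n G X) where
  carrier : Set G
  closed : IsClosed carrier
  secS : X → G
  secT : X → G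
  secS_smooth : ContMDiff 𝓘(ℝ, BaseModel n) 𝓘(ℝ, PhaseModel n) ∞ secS
  secT_smooth : ContMDiff 𝓘(ℝ, BaseModel n) 𝓘(ℝ, PhaseModel n) ∞ secT
  src_secS : ∀ x, 𝒢.src (secS x) = x
  tgt_secT : ∀ x, 𝒢.tgt (secT x) = x
  range_secS : Set.range secS = carrier
  range_secT : Set.range secT = carrier

/-- The right action of a bisection: `R_Σ(g) = g ∘ σ`, where `σ` is the element of `Σ` whose
target is the source of `g`. -/
def Bisection.rightAction {𝒢 : LocalSymplecticGroupoid n G X} (S : Bisection 𝒢) : G → G :=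
  fun g => 𝒢.mul g (S.secT (𝒢.src g))

/-- The set on which the right action is defined. -/
def Bisection.rightDomain {𝒢 : LocalSymplecticGroupoid n G X} (S : Bisection 𝒢) : Set G :=
  {g | (g, S.secT (𝒢.src g)) ∈ 𝒢.composable}

/-- The transformed symplectic form `R_Σ^*ω`. -/
def Bisection.transformedForm {𝒢 : LocalSymplecticGroupoid n G X} (S : Bisection 𝒢) :
    TwoForm 𝓘(ℝ, PhaseModel n) G :=
  pullback 𝓘(ℝ, PhaseModel n) 𝓘(ℝ, PhaseModel n) S.rightAction 𝒢.form

/-- The invariant field strength `F^t = Σ_t^*ω`, a two-form on `X`. -/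
def Bisection.invariantFieldStrength {𝒢 : LocalSymplecticGroupoid n G X} (S : Bisection 𝒢) :
    TwoForm 𝓘(ℝ, BaseModel n) X :=
  pullback 𝓘(ℝ, BaseModel n) 𝓘(ℝ, PhaseModel n) S.secT 𝒢.form

/-- Local coordinates `(y, π)` on `G` of cotangent type: `y` is the pullback by the source map of
coordinates on `X`, the units are the locus `π = 0`, and `(Q, π)` are Darboux coordinates,
`ω = dπ_μ ∧ dQ^μ`, for some functions `Q = Q(y, π)`. -/
structure CotangentChart (𝒢 : LocalSymplecticGroupoid n G X) where
  chart : OpenPartialHomeomorph G (PhaseModel n)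
  chart_mem : chart ∈ IsManifold.maximalAtlas 𝓘(ℝ, PhaseModel n) ∞ G
  baseChart : OpenPartialHomeomorph X (BaseModel n)
  baseChart_mem : baseChart ∈ IsManifold.maximalAtlas 𝓘(ℝ, BaseModel n) ∞ X
  src_mem : ∀ g ∈ chart.source, 𝒢.src g ∈ baseChart.source
  fst_eq : ∀ g ∈ chart.source, (chart g).1 = baseChart (𝒢.src g)
  snd_eq_zero_iff : ∀ g ∈ chart.source, (chart g).2 = 0 ↔ g = 𝒢.unit (𝒢.src g)
  Q : Fin n → G → ℝ
  Q_smooth : ∀ μ, ContMDiffOn 𝓘(ℝ, PhaseModel n) 𝓘(ℝ, ℝ) ∞ (Q μ) chart.source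
  darboux : ∀ g ∈ chart.source, ∀ u v : TangentSpace 𝓘(ℝ, PhaseModel n) g,
    𝒢.form g ![u, v] = ∑ μ,
      (mvfderiv 𝓘(ℝ, PhaseModel n) (fun h => (chart h).2 μ) g u *
          mvfderiv 𝓘(ℝ, PhaseModel n) (Q μ) g v
        - mvfderiv 𝓘(ℝ, PhaseModel n) (fun h => (chart h).2 μ) g v *
          mvfderiv 𝓘(ℝ, PhaseModel n) (Q μ) g u)

variable {𝒢 : LocalSymplecticGroupoid n G X}

/-- The coordinate function `y^l` on `G`. -/
def CotangentChart.y (C : CotangentChart 𝒢) (l : Fin n) : G → ℝ := fun g => (C.chart g).1 l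

/-- The momentum coordinate function `π_m` on `G`. -/
def CotangentChart.π (C : CotangentChart 𝒢) (m : Fin n) : G → ℝ := fun g => (C.chart g).2 m

/-- The differential `dy^l` at `g`. -/
def CotangentChart.dy (C : CotangentChart 𝒢) (l : Fin n) (g : G) :
    TangentSpace 𝓘(ℝ, PhaseModel n) g →L[ℝ] ℝ := mvfderiv 𝓘(ℝ, PhaseModel n) (C.y l) g

/-- The differential `dπ_m` at `g`. -/
def CotangentChart.dπ (C : CotangentChart 𝒢) (m : Fin n) (g : G) :
    TangentSpace 𝓘(ℝ, PhaseModel n) g →L[ℝ] ℝ := mvfderiv 𝓘(ℝ, PhaseModel n) (C.π m) g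

/-- The coordinate vector `∂/∂y^a` of the base at `x`. -/
def CotangentChart.baseVector (C : CotangentChart 𝒢) (a : Fin n) (x : X) :
    TangentSpace 𝓘(ℝ, BaseModel n) x :=
  (mvfderiv 𝓘(ℝ, BaseModel n) C.baseChart x).inverse (Pi.single a 1)

/-- The matrix `F^t_{ab} = F^t(∂_a, ∂_b)` at the point `x` of the base. -/
def CotangentChart.Ft (C : CotangentChart 𝒢) (S : Bisection 𝒢) (x : X) :
    Matrix (Fin n) (Fin n) ℝ :=
  Matrix.of fun a b => S.invariantFieldStrength x ![C.baseVector a x, C.baseVector b x]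

/-- The matrix of brackets `{π_a, π_b}_A` for the Poisson structure inverse to `R_Σ^*ω`,
at the point `g`. Its restriction to `π = 0` is the field strength `𝓕̂`. -/
def CotangentChart.momentumBrackets (C : CotangentChart 𝒢) (S : Bisection 𝒢) (g : G) :
    Matrix (Fin n) (Fin n) ℝ :=
  Matrix.of fun a b => formBracket S.transformedForm (C.π a) (C.π b) g

end Groupoid

end PoissonGauge

end

/-! The theorem reduces to the gauge formula `R_Σ^*ω = ω + s^*F^t` and linear algebra at each point.
The map h ↦ (R_Σ(h), h, Σ_t(s(h))) takes values in the graph of the multiplication, so the form −ω +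
ω + ω vanishes on pairs of vectors in the image of its differential; read off on the three factors,
this is `Bisection.transformedForm_apply`.

Nondegeneracy: s(g) is recovered from R_Σ(g), so a vector killed by dR_Σ is killed by ds. By the
gauge formula it is then in the kernel of ω. Hence dR_Σ is injective, bijective by dimension, and
the pullback of ω stays nondegenerate.

In the coordinates (y, π), ω = dπ ∧ dQ vanishes on pairs of vectors with dπ = 0, so its matrix has
blocks 0, Γ, Ξ, and Γ is invertible because ω is nondegenerate. Since y is pulled back by s, adding
s^*F^t changes only the yy-block. Thus R = F^t, while Γ and Ξ are those of ω.

Put K = Γ⁻ᵀ F^t Γ⁻¹. Inverting the block form gives {π_a, π_b}_A = (K(1 + ΞK)⁻¹)_{ab}, where 1 + ΞK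
is invertible by nondegeneracy (`HasBlocks.isUnit_one_add`, `HasBlocks.inversePairing_snd`). Both
relations between field strengths follow from K(1 + ΞK)⁻¹ = (1 + KΞ)⁻¹K
(`field_strength_relations`). -/

noncomputable section

namespace PoissonGauge

/-! ### Linear algebra: block form of a two-form and its inverse pairing -/

section LinearAlgebra

variable {V : Type*} [AddCommGroup V] [Module ℝ V] [TopologicalSpace V]

theorem apply_swap (B : V [⋀^Fin 2]→L[ℝ] ℝ) (u v : V) : B ![u, v] = -B ![v, u] := by
  have h : B.toAlternatingMap (![v, u] ∘ Equiv.swap 0 1) = -B ![v, u] :=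
    B.toAlternatingMap.map_swap ![v, u] (by decide)
  rw [← h]
  change B _ = B _
  congr 1
  ext i
  fin_cases i <;> rfl

/-- The bilinear map underlying a two-form. -/
def bilin (B : V [⋀^Fin 2]→L[ℝ] ℝ) : V →ₗ[ℝ] V →ₗ[ℝ] ℝ :=
  LinearMap.mk₂ ℝ (fun u v => B ![u, v])
    (fun u u' v => B.vecCons_add ![v] u u')
    (fun c u v => B.vecCons_smul ![v] c u)
    (fun u v v' => by
      rw [apply_swap, apply_swap B u v, apply_swap B u v', B.vecCons_add ![u] v v', neg_add])
    (fun c u v => by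
      rw [apply_swap, apply_swap B u v, B.vecCons_smul ![u] c v, smul_neg])

theorem bilin_apply (B : V [⋀^Fin 2]→L[ℝ] ℝ) (u v : V) : bilin B u v = B ![u, v] := rfl

/-- Nondegeneracy makes the representing vector unique, so any explicit solution computes the
pairing. The swap is needed because `Nondegenerate` concerns the first slot and the representing
vector sits in the second. -/
theorem inversePairing_eq {B : V [⋀^Fin 2]→L[ℝ] ℝ} (hB : Nondegenerate B) {α β : V →L[ℝ] ℝ}
    {v : V} (hv : ∀ w, B ![w, v] = β w) : inversePairing B α β = α v := by
  have h : ∃ v : V, ∀ w : V, B ![w, v] = β w := ⟨v, hv⟩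
  rw [inversePairing, dif_pos h]
  have key : h.choose - v = 0 := by
    refine hB _ fun w => ?_
    rw [apply_swap, ← bilin_apply, map_sub, bilin_apply, bilin_apply, h.choose_spec w, hv w]
    simp
  rw [sub_eq_zero.1 key]

variable {n : ℕ}

/-- `B` has the block matrix `[[R, -Γᵀ], [Γ, Ξ]]` in the coordinates `e = (y, π)`. -/
def HasBlocks (B : V [⋀^Fin 2]→L[ℝ] ℝ) (e : V ≃ₗ[ℝ] (Fin n → ℝ) × (Fin n → ℝ))
    (R Γ Ξ : Matrix (Fin n) (Fin n) ℝ) : Prop :=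
  ∀ u v, B ![u, v] = (e u).1 ⬝ᵥ R *ᵥ (e v).1 + (e u).2 ⬝ᵥ Γ *ᵥ (e v).1
    - (e v).2 ⬝ᵥ Γ *ᵥ (e u).1 + (e u).2 ⬝ᵥ Ξ *ᵥ (e v).2

theorem dotProduct_of_mulVec {V : Type*} [AddCommGroup V] [Module ℝ V] (b : V →ₗ[ℝ] V →ₗ[ℝ] ℝ) {f g : (Fin n → ℝ) →ₗ[ℝ] V}
    (x y : Fin n → ℝ) :
    x ⬝ᵥ (Matrix.of fun i j => b (f (Pi.single i 1)) (g (Pi.single j 1))) *ᵥ y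
      = b (f x) (g y) := by
  have := LinearMap.sum_repr_mul_repr_mul (B := (b.compl₁₂ f g)) (Pi.basisFun ℝ (Fin n)) 
    (Pi.basisFun ℝ (Fin n)) x y
  simp only [LinearMap.compl₁₂_apply] at this
  rw [← this]
  simp [dotProduct, Matrix.mulVec, Finsupp.sum_fintype, Finset.mul_sum, mul_comm]

variable {B : V [⋀^Fin 2]→L[ℝ] ℝ} {e : V ≃ₗ[ℝ] (Fin n → ℝ) × (Fin n → ℝ)}
  {R Γ Ξ : Matrix (Fin n) (Fin n) ℝ}

/-- When the yy-block vanishes, p in the kernel of Γ makes the vector (p, 0) orthogonal to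
everything. -/
theorem HasBlocks.isUnit_of_nondegenerate (h : HasBlocks B e 0 Γ Ξ) (hB : Nondegenerate B) :
    IsUnit Γ := by
  rw [← Matrix.mulVec_injective_iff_isUnit, ← Matrix.coe_mulVecLin, injective_iff_map_eq_zero']
  refine fun p => ⟨fun hp => ?_, fun hp => by simp [hp]⟩
  have hu := hB (e.symm (p, 0)) fun v => by
    rw [h]; simp at hp; simp [hp]
  simpa using hu

/-- The vectors `(Γ⁻¹ c, K c)` with `K = Γ⁻ᵀ R Γ⁻¹` span the `B`-orthogonal of `π = 0`. -/
theorem HasBlocks.apply_graph (h : HasBlocks B e R Γ Ξ) (hΓ : IsUnit Γ) (c : Fin n → ℝ) (w : V) :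
    B ![w, e.symm (Γ⁻¹ *ᵥ c, ((Γ⁻¹)ᵀ * R * Γ⁻¹) *ᵥ c)]
      = (e w).2 ⬝ᵥ (1 + Ξ * ((Γ⁻¹)ᵀ * R * Γ⁻¹)) *ᵥ c := by
  have h1 : Γ * Γ⁻¹ = 1 := Matrix.mul_nonsing_inv _ ((Matrix.isUnit_iff_isUnit_det _).1 hΓ)
  have h2 : Γᵀ * ((Γ⁻¹)ᵀ * R * Γ⁻¹) = R * Γ⁻¹ := by
    have : Γᵀ * (Γ⁻¹)ᵀ = 1 := by
      rw [← Matrix.transpose_mul, Matrix.nonsing_inv_mul _ ((Matrix.isUnit_iff_isUnit_det _).1 hΓ),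
        Matrix.transpose_one]
    rw [← Matrix.mul_assoc, ← Matrix.mul_assoc, this, Matrix.one_mul]
  -- This is the cancellation that dictates K: the two terms containing dy(w) are equal because Γᵀ K
  -- = R Γ⁻¹.
  have h3 : (((Γ⁻¹)ᵀ * R * Γ⁻¹) *ᵥ c) ⬝ᵥ Γ *ᵥ (e w).1 = (e w).1 ⬝ᵥ R *ᵥ Γ⁻¹ *ᵥ c := by
    rw [dotProduct_comm, ← Matrix.vecMul_transpose, ← Matrix.dotProduct_mulVec,
      Matrix.mulVec_mulVec, h2, Matrix.mulVec_mulVec]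
  rw [h, LinearEquiv.apply_symm_apply]
  dsimp only
  rw [h3, Matrix.mulVec_mulVec _ Γ, h1, Matrix.add_mulVec, dotProduct_add, Matrix.mulVec_mulVec _ Ξ]
  ring

/-- By `HasBlocks.apply_graph`, a kernel vector c yields (Γ⁻¹c, Kc) in the kernel of B; its first
component then forces c = 0. -/
theorem HasBlocks.isUnit_one_add (h : HasBlocks B e R Γ Ξ) (hB : Nondegenerate B)
    (hΓ : IsUnit Γ) : IsUnit (1 + Ξ * ((Γ⁻¹)ᵀ * R * Γ⁻¹)) := by
  rw [← Matrix.mulVec_injective_iff_isUnit, ← Matrix.coe_mulVecLin, injective_iff_map_eq_zero']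
  refine fun c => ⟨fun hc => ?_, fun hc => by simp [hc]⟩
  rw [Matrix.mulVecLin_apply] at hc
  have hu := hB (e.symm (Γ⁻¹ *ᵥ c, ((Γ⁻¹)ᵀ * R * Γ⁻¹) *ᵥ c)) fun v => by
    rw [apply_swap, h.apply_graph hΓ, hc, dotProduct_zero, neg_zero]
  have h0 : Γ⁻¹ *ᵥ c = 0 := by simpa using congrArg (fun z => (e z).1) hu
  have := congrArg (Γ *ᵥ ·) h0
  simpa [Matrix.mulVec_mulVec, Matrix.mul_nonsing_inv _ ((Matrix.isUnit_iff_isUnit_det _).1 hΓ)]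
    using this

/-- The covector dπ_b is represented by (Γ⁻¹c, Kc) with c = (1 + ΞK)⁻¹ e_b; its π_a-component is the
asserted entry. -/
theorem HasBlocks.inversePairing_snd (h : HasBlocks B e R Γ Ξ) (hB : Nondegenerate B)
    (hΓ : IsUnit Γ) {α β : V →L[ℝ] ℝ} {a b : Fin n} (hα : ∀ v, α v = (e v).2 a)
    (hβ : ∀ v, β v = (e v).2 b) :
    inversePairing B α β
      = (((Γ⁻¹)ᵀ * R * Γ⁻¹) * (1 + Ξ * ((Γ⁻¹)ᵀ * R * Γ⁻¹))⁻¹) a b := by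
  have hN := (Matrix.isUnit_iff_isUnit_det _).1 (h.isUnit_one_add hB hΓ)
  rw [inversePairing_eq hB (v := e.symm
    (Γ⁻¹ *ᵥ (1 + Ξ * ((Γ⁻¹)ᵀ * R * Γ⁻¹))⁻¹ *ᵥ Pi.single b 1,
      ((Γ⁻¹)ᵀ * R * Γ⁻¹) *ᵥ (1 + Ξ * ((Γ⁻¹)ᵀ * R * Γ⁻¹))⁻¹ *ᵥ Pi.single b 1)), hα,
    LinearEquiv.apply_symm_apply]
  · simp only [Matrix.mulVec_mulVec]
    rw [Matrix.mulVec_single_one, Matrix.col_apply]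
  · intro w
    rw [h.apply_graph hΓ, Matrix.mulVec_mulVec, Matrix.mul_nonsing_inv _ hN, hβ]
    rw [Matrix.one_mulVec, dotProduct_single_one]

end LinearAlgebra

/-! ### Matrix identities between the two field strengths -/

/-- The relations between `K` and the bracket matrix `K (1 + Ξ K)⁻¹`. -/
theorem field_strength_relations {n : ℕ} {F Γ Ξ Φ : Matrix (Fin n) (Fin n) ℝ} (hΓ : IsUnit Γ)
    (hN : IsUnit (1 + Ξ * ((Γ⁻¹)ᵀ * F * Γ⁻¹)))
    (hΦ : Φ = ((Γ⁻¹)ᵀ * F * Γ⁻¹) * (1 + Ξ * ((Γ⁻¹)ᵀ * F * Γ⁻¹))⁻¹) :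
    IsUnit (1 + (Γ⁻¹)ᵀ * F * Γ⁻¹ * Ξ) ∧
    Φ = (1 + (Γ⁻¹)ᵀ * F * Γ⁻¹ * Ξ)⁻¹ * ((Γ⁻¹)ᵀ * F * Γ⁻¹) ∧
    IsUnit (1 - Γᵀ * Φ * Γ * (Γ⁻¹ * Ξ * (Γ⁻¹)ᵀ)) ∧
    F = (1 - Γᵀ * Φ * Γ * (Γ⁻¹ * Ξ * (Γ⁻¹)ᵀ))⁻¹ * (Γᵀ * Φ * Γ) := by
  have hΓd := (Matrix.isUnit_iff_isUnit_det _).1 hΓ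
  have g1 : Γ * Γ⁻¹ = 1 := Matrix.mul_nonsing_inv _ hΓd
  have g2 : Γ⁻¹ * Γ = 1 := Matrix.nonsing_inv_mul _ hΓd
  have g3 : Γᵀ * (Γ⁻¹)ᵀ = 1 := by rw [← Matrix.transpose_mul, g2, Matrix.transpose_one]
  have g4 : (Γ⁻¹)ᵀ * Γᵀ = 1 := by rw [← Matrix.transpose_mul, g1, Matrix.transpose_one]
  obtain ⟨K, hK⟩ : ∃ K, K = (Γ⁻¹)ᵀ * F * Γ⁻¹ := ⟨_, rfl⟩
  rw [← hK] at hN hΦ ⊢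
  have hF : F = Γᵀ * K * Γ := by
    calc F = 1 * F * 1 := by simp
      _ = (Γᵀ * (Γ⁻¹)ᵀ) * F * (Γ⁻¹ * Γ) := by rw [g3, g2]
      _ = _ := by rw [hK]; simp only [Matrix.mul_assoc]
  have hNd := (Matrix.isUnit_iff_isUnit_det _).1 hN
  -- Sylvester's identity det(1 + KΞ) = det(1 + ΞK).
  have hMd : IsUnit (1 + K * Ξ).det := by rwa [Matrix.det_one_add_mul_comm]
  have m1 := Matrix.mul_nonsing_inv _ hMd
  have m2 := Matrix.nonsing_inv_mul _ hMd
  have hΦ' : Φ = (1 + K * Ξ)⁻¹ * K := by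
    -- Push-through identity: it moves the inverse from the right of K to its left.
    have hc : (1 + K * Ξ) * K = K * (1 + Ξ * K) := by noncomm_ring
    calc Φ = (1 + K * Ξ)⁻¹ * ((1 + K * Ξ) * K) * (1 + Ξ * K)⁻¹ := by
          rw [← Matrix.mul_assoc, m2, Matrix.one_mul, hΦ]
      _ = _ := by rw [hc, Matrix.mul_assoc, Matrix.mul_assoc, Matrix.mul_nonsing_inv _ hNd,
                    Matrix.mul_one]
  -- The second matrix is conjugate by Γᵀ to 1 − ΦΞ = (1 + KΞ)⁻¹, hence invertible with explicit
  -- inverse Γᵀ(1 + KΞ)Γ⁻ᵀ.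
  have hP : 1 - Γᵀ * Φ * Γ * (Γ⁻¹ * Ξ * (Γ⁻¹)ᵀ) = Γᵀ * (1 + K * Ξ)⁻¹ * (Γ⁻¹)ᵀ := by
    have e1 : Γᵀ * Φ * Γ * (Γ⁻¹ * Ξ * (Γ⁻¹)ᵀ) = Γᵀ * (Φ * Ξ) * (Γ⁻¹)ᵀ := by
      calc _ = Γᵀ * Φ * (Γ * Γ⁻¹) * (Ξ * (Γ⁻¹)ᵀ) := by simp only [Matrix.mul_assoc]
        _ = _ := by rw [g1]; simp only [Matrix.mul_assoc, Matrix.one_mul]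
    have e2 : (1 + K * Ξ)⁻¹ = 1 - Φ * Ξ := by
      rw [eq_sub_iff_add_eq, hΦ', Matrix.mul_assoc]
      calc _ = (1 + K * Ξ)⁻¹ * (1 + K * Ξ) := by rw [Matrix.mul_add, Matrix.mul_one]
        _ = 1 := m2
    rw [e1, e2, Matrix.mul_sub, Matrix.sub_mul, Matrix.mul_one, g3]
  have q1 : (Γᵀ * (1 + K * Ξ) * (Γ⁻¹)ᵀ) * (Γᵀ * (1 + K * Ξ)⁻¹ * (Γ⁻¹)ᵀ) = 1 := by
    calc _ = Γᵀ * ((1 + K * Ξ) * ((Γ⁻¹)ᵀ * Γᵀ) * (1 + K * Ξ)⁻¹) * (Γ⁻¹)ᵀ := by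
          simp only [Matrix.mul_assoc]
      _ = 1 := by rw [g4, Matrix.mul_one, m1, Matrix.mul_one, g3]
  refine ⟨(Matrix.isUnit_iff_isUnit_det _).2 hMd, hΦ', ?_, ?_⟩
  · rw [hP, Matrix.isUnit_iff_isUnit_det]
    exact Matrix.isUnit_det_of_left_inverse q1
  · rw [hP, Matrix.inv_eq_left_inv q1, hΦ']
    calc F = Γᵀ * ((1 + K * Ξ) * (1 + K * Ξ)⁻¹) * K * Γ := by rw [m1, Matrix.mul_one, hF]
      _ = Γᵀ * (1 + K * Ξ) * ((Γ⁻¹)ᵀ * Γᵀ) * (1 + K * Ξ)⁻¹ * K * Γ := by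
          rw [g4, Matrix.mul_one]; simp only [Matrix.mul_assoc]
      _ = _ := by simp only [Matrix.mul_assoc]

/-! ### Functoriality of the pullback -/

section Pullback

variable {E H E' H' E'' H'' : Type*} [NormedAddCommGroup E] [NormedSpace ℝ E] [TopologicalSpace H]
  [NormedAddCommGroup E'] [NormedSpace ℝ E'] [TopologicalSpace H']
  [NormedAddCommGroup E''] [NormedSpace ℝ E''] [TopologicalSpace H'']
  {I : ModelWithCorners ℝ E H} {J : ModelWithCorners ℝ E' H'} {K : ModelWithCorners ℝ E'' H''}
  {M N P : Type*} [TopologicalSpace M] [ChartedSpace H M] [TopologicalSpace N]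
  [ChartedSpace H' N] [TopologicalSpace P] [ChartedSpace H'' P]

theorem pullback_apply (f : M → N) (Ω : TwoForm J N) (x : M) (u v : TangentSpace I x) :
    pullback I J f Ω x ![u, v] = Ω (f x) ![mfderiv I J f x u, mfderiv I J f x v] := by
  change Ω (f x) _ = _
  congr 1
  ext i
  fin_cases i <;> rfl

theorem pullback_mfderiv_apply {p : N → P} {f : M → N} (Ω : TwoForm K P) {x : M}
    (hp : MDifferentiableAt J K p (f x)) (hf : MDifferentiableAt I J f x)
    (u v : TangentSpace I x) :
    pullback J K p Ω (f x) ![mfderiv I J f x u, mfderiv I J f x v]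
      = pullback I K (p ∘ f) Ω x ![u, v] := by
  rw [pullback_apply, pullback_apply, mfderiv_comp x hp hf]
  rfl

theorem pullback_id (Ω : TwoForm I M) (x : M) (u v : TangentSpace I x) :
    pullback I I (id : M → M) Ω x ![u, v] = Ω x ![u, v] := by
  rw [pullback_apply, mfderiv_id]
  rfl

end Pullback

/-! ### Tangent vectors as velocities of curves -/

section TangentSet

theorem mdifferentiable_of_mem_maximalAtlas {E M : Type*} [NormedAddCommGroup E] [NormedSpace ℝ E]
    [TopologicalSpace M] [ChartedSpace E M] {φ : OpenPartialHomeomorph M E}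
    (hφ : φ ∈ IsManifold.maximalAtlas 𝓘(ℝ, E) ∞ M) :
    φ.MDifferentiable 𝓘(ℝ, E) 𝓘(ℝ, E) :=
  ⟨(contMDiffOn_of_mem_maximalAtlas hφ).mdifferentiableOn (by simp),
    (contMDiffOn_symm_of_mem_maximalAtlas hφ).mdifferentiableOn (by simp)⟩

variable {E E' H' : Type*} [NormedAddCommGroup E] [NormedSpace ℝ E]
  [NormedAddCommGroup E'] [NormedSpace ℝ E'] [TopologicalSpace H']
  {J : ModelWithCorners ℝ E' H'}
  {M N : Type*} [TopologicalSpace M] [ChartedSpace E M] [IsManifold 𝓘(ℝ, E) ∞ M]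
  [TopologicalSpace N] [ChartedSpace H' N]

/-- Every tangent vector is the velocity of a smooth curve. -/
theorem exists_curve_tangentMap (x : M) (u : TangentSpace 𝓘(ℝ, E) x) :
    ∃ c : ℝ → M, ContMDiffAt 𝓘(ℝ, ℝ) 𝓘(ℝ, E) ∞ c 0 ∧
      tangentMap 𝓘(ℝ, ℝ) 𝓘(ℝ, E) c ⟨0, (NormedSpace.fromTangentSpace (𝕜 := ℝ) (0 : ℝ)).symm 1⟩ =
        (⟨x, u⟩ : TangentBundle 𝓘(ℝ, E) M) := by
  have hmem : chartAt E x ∈ IsManifold.maximalAtlas 𝓘(ℝ, E) ∞ M :=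
    IsManifold.chart_mem_maximalAtlas x
  have hx := mem_chart_source E x
  have hd := mdifferentiable_of_mem_maximalAtlas hmem
  let w : E := mfderiv 𝓘(ℝ, E) 𝓘(ℝ, E) (chartAt E x) x u
  -- The curve is a straight line in the preferred chart at x, with velocity the image w of u.
  let ℓ : ℝ → E := fun τ => chartAt E x x + τ • w
  have hℓ0 : ℓ 0 = chartAt E x x := by simp [ℓ]
  have hℓ : ContDiff ℝ ∞ ℓ := by fun_prop
  have hs : ContMDiffAt 𝓘(ℝ, E) 𝓘(ℝ, E) ∞ (chartAt E x).symm (ℓ 0) := by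
    rw [hℓ0]
    exact contMDiffAt_symm_of_mem_maximalAtlas hmem ((chartAt E x).map_source hx)
  refine ⟨(chartAt E x).symm ∘ ℓ, hs.comp 0 hℓ.contMDiff.contMDiffAt, ?_⟩
  have hℓd : HasDerivAt ℓ w 0 := by
    have h := ((hasDerivAt_id (0 : ℝ)).smul_const w).const_add (chartAt E x x)
    rwa [one_smul] at h
  rw [tangentMap_comp_at _ (hs.mdifferentiableAt (by simp))
    (hℓ.contMDiff.contMDiffAt.mdifferentiableAt (by simp))]
  have h1 : tangentMap 𝓘(ℝ, ℝ) 𝓘(ℝ, E) ℓ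
      ⟨0, (NormedSpace.fromTangentSpace (𝕜 := ℝ) (0 : ℝ)).symm 1⟩ =
      (⟨chartAt E x x, w⟩ : TangentBundle 𝓘(ℝ, E) E) := by
    rw [tangentMap, hℓ0, mfderiv_eq_fderiv]
    congr 1
    change fderiv ℝ ℓ 0 (1 : ℝ) = w
    rw [hℓd.hasFDerivAt.fderiv]
    simp
  rw [h1, tangentMap]
  have h2 := DFunLike.congr_fun (hd.symm_comp_deriv hx) u
  have h3 := (chartAt E x).left_inv hx
  rw [Bundle.TotalSpace.mk.injEq]
  exact ⟨h3, heq_of_eq h2⟩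

/-- The differential of a map into `S` takes values in the tangent vectors of `S`. -/
theorem mfderiv_mem_tangentSet {f : M → N} {S : Set N} {x : M}
    (hf : ContMDiffAt 𝓘(ℝ, E) J ∞ f x) (hS : ∀ᶠ y in 𝓝 x, f y ∈ S) (u : TangentSpace 𝓘(ℝ, E) x) :
    mfderiv 𝓘(ℝ, E) J f x u ∈ tangentSet J S (f x) := by
  obtain ⟨c, hc, hcu⟩ := exists_curve_tangentMap x u
  have hc0 : c 0 = x := congrArg Bundle.TotalSpace.proj hcu
  rw [← hc0] at hf hS
  refine ⟨f ∘ c, hf.comp 0 hc, hc.continuousAt.eventually hS, ?_⟩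
  rw [tangentMap_comp_at _ (hf.mdifferentiableAt (by simp)) (hc.mdifferentiableAt (by simp)), hcu]
  rfl

end TangentSet

/-! ### The right action of a bisection and the gauge formula -/

section Action

variable {n : ℕ} {G X : Type*} [TopologicalSpace G] [ChartedSpace (PhaseModel n) G]
  [TopologicalSpace X] [ChartedSpace (BaseModel n) X] {𝒢 : LocalSymplecticGroupoid n G X}
  (S : Bisection 𝒢)

theorem Bisection.contMDiff_secT_src :
    ContMDiff 𝓘(ℝ, PhaseModel n) 𝓘(ℝ, PhaseModel n) ∞ (S.secT ∘ 𝒢.src) :=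
  S.secT_smooth.comp 𝒢.src_smooth

theorem Bisection.isOpen_rightDomain : IsOpen S.rightDomain := by
  obtain ⟨O, hO, h⟩ := 𝒢.composable_open
  -- The matching condition s = t holds automatically since Σ_t is a section of the target, so
  -- relative openness becomes openness in G.
  have : S.rightDomain = (fun g => (g, S.secT (𝒢.src g))) ⁻¹' O := by
    ext g
    simp [Bisection.rightDomain, h, S.tgt_secT]
  rw [this]
  exact hO.preimage (continuous_id.prodMk S.contMDiff_secT_src.continuous)

theorem Bisection.contMDiffOn_rightAction :
    ContMDiffOn 𝓘(ℝ, PhaseModel n) 𝓘(ℝ, PhaseModel n) ∞ S.rightAction S.rightDomain :=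
  𝒢.mul_smooth.comp (contMDiff_id.prodMk S.contMDiff_secT_src).contMDiffOn fun _ hg => hg

theorem Bisection.contMDiffAt_rightAction {g : G} (hg : g ∈ S.rightDomain) :
    ContMDiffAt 𝓘(ℝ, PhaseModel n) 𝓘(ℝ, PhaseModel n) ∞ S.rightAction g :=
  S.contMDiffOn_rightAction.contMDiffAt (S.isOpen_rightDomain.mem_nhds hg)

/-- The source of g ∘ σ is the source of σ. Applying `secS` therefore returns σ itself, whose target
is s(g): the action does not lose the source of g. -/
theorem Bisection.tgt_secS_src_rightAction {g : G} (hg : g ∈ S.rightDomain) :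
    𝒢.tgt (S.secS (𝒢.src (S.rightAction g))) = 𝒢.src g := by
  rw [Bisection.rightAction, 𝒢.src_mul _ _ hg]
  obtain ⟨z, hz⟩ : S.secT (𝒢.src g) ∈ Set.range S.secS := by
    rw [S.range_secS, ← S.range_secT]
    exact Set.mem_range_self _
  rw [← hz, S.src_secS, hz, S.tgt_secT]

theorem Bisection.mfderiv_src_eq_zero {g : G} (hg : g ∈ S.rightDomain)
    {u : TangentSpace 𝓘(ℝ, PhaseModel n) g}
    (hu : mfderiv 𝓘(ℝ, PhaseModel n) 𝓘(ℝ, PhaseModel n) S.rightAction g u = 0) :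
    mfderiv 𝓘(ℝ, PhaseModel n) 𝓘(ℝ, BaseModel n) 𝒢.src g u = 0 := by
  have hsm : ContMDiff 𝓘(ℝ, PhaseModel n) 𝓘(ℝ, BaseModel n) ∞ (𝒢.tgt ∘ S.secS ∘ 𝒢.src) :=
    𝒢.tgt_smooth.comp (S.secS_smooth.comp 𝒢.src_smooth)
  have hev : (𝒢.tgt ∘ S.secS ∘ 𝒢.src) ∘ S.rightAction =ᶠ[𝓝 g] 𝒢.src := by
    filter_upwards [S.isOpen_rightDomain.mem_nhds hg] with h hh
    exact S.tgt_secS_src_rightAction hh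
  have h := mfderiv_comp g (hsm.mdifferentiable (by simp) (S.rightAction g))
    ((S.contMDiffAt_rightAction hg).mdifferentiableAt (by simp))
  have h2 := DFunLike.congr_fun (hev.mfderiv_eq.symm.trans h) u
  refine h2.trans ?_
  change mfderiv 𝓘(ℝ, PhaseModel n) 𝓘(ℝ, BaseModel n) (𝒢.tgt ∘ S.secS ∘ 𝒢.src) (S.rightAction g)
    (mfderiv 𝓘(ℝ, PhaseModel n) 𝓘(ℝ, PhaseModel n) S.rightAction g u) = 0
  rw [hu, map_zero]

theorem Bisection.unit_mem_rightDomain (x : X) : 𝒢.unit x ∈ S.rightDomain := by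
  have h := (𝒢.unit_mul (S.secT x)).1
  rw [S.tgt_secT] at h
  change (𝒢.unit x, S.secT (𝒢.src (𝒢.unit x))) ∈ 𝒢.composable
  rwa [𝒢.src_unit]

variable [IsManifold 𝓘(ℝ, PhaseModel n) ∞ G]

/-- The gauge transformation `R_Σ^*ω = ω + s^*F^t`. -/
theorem Bisection.transformedForm_apply {g : G} (hg : g ∈ S.rightDomain)
    (u v : TangentSpace 𝓘(ℝ, PhaseModel n) g) :
    S.transformedForm g ![u, v] = 𝒢.form g ![u, v]
      + S.invariantFieldStrength (𝒢.src g)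
        ![mfderiv 𝓘(ℝ, PhaseModel n) 𝓘(ℝ, BaseModel n) 𝒢.src g u,
          mfderiv 𝓘(ℝ, PhaseModel n) 𝓘(ℝ, BaseModel n) 𝒢.src g v] := by
  let f : G → G × G × G := fun h => (S.rightAction h, h, (S.secT ∘ 𝒢.src) h)
  have hf : ContMDiffAt 𝓘(ℝ, PhaseModel n)
      (𝓘(ℝ, PhaseModel n).prod (𝓘(ℝ, PhaseModel n).prod 𝓘(ℝ, PhaseModel n))) ∞ f g :=
    (S.contMDiffAt_rightAction hg).prodMk
      (contMDiffAt_id.prodMk S.contMDiff_secT_src.contMDiffAt)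
  have hgraph : ∀ᶠ h in 𝓝 g, f h ∈
      {q : G × G × G | (q.2.1, q.2.2) ∈ 𝒢.composable ∧ q.1 = 𝒢.mul q.2.1 q.2.2} := by
    filter_upwards [S.isOpen_rightDomain.mem_nhds hg] with h hh
    exact ⟨hh, rfl⟩
  -- Both vectors are tangent to the graph, on which the signed sum of the three pullbacks vanishes.
  have key := (𝒢.graph_lagrangian (f g) hgraph.self_of_nhds _).1
    (mfderiv_mem_tangentSet hf hgraph u) _ (mfderiv_mem_tangentSet hf hgraph v)
  have hfd := hf.mdifferentiableAt (by simp)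
  simp only [ContinuousAlternatingMap.add_apply, ContinuousAlternatingMap.neg_apply] at key
  rw [pullback_mfderiv_apply _ mdifferentiableAt_fst hfd,
    pullback_mfderiv_apply (p := fun r : G × G × G => r.2.1) _
      (mdifferentiableAt_fst.comp _ mdifferentiableAt_snd) hfd,
    pullback_mfderiv_apply (p := fun r : G × G × G => r.2.2) _
      (mdifferentiableAt_snd.comp _ mdifferentiableAt_snd) hfd] at key
  have h1 : pullback 𝓘(ℝ, PhaseModel n) 𝓘(ℝ, PhaseModel n)
      ((fun r : G × G × G => r.2.1) ∘ f) 𝒢.form g ![u, v] = 𝒢.form g ![u, v] := pullback_id _ _ _ _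
  have h2 := pullback_mfderiv_apply (p := S.secT) 𝒢.form
    (S.secT_smooth.mdifferentiable (by simp) (𝒢.src g))
    (𝒢.src_smooth.mdifferentiable (by simp) g) u v
  rw [h1] at key
  change -(S.transformedForm g ![u, v]) + _ + _ = 0 at key
  rw [Bisection.invariantFieldStrength, h2]
  change -(S.transformedForm g ![u, v]) + _ +
    pullback 𝓘(ℝ, PhaseModel n) 𝓘(ℝ, PhaseModel n) (S.secT ∘ 𝒢.src) 𝒢.form g ![u, v] = 0 at key
  linarith

/-- If dR_Σ u = 0, then ds u = 0 as well, so the gauge formula reduces to ω(u, v) = 0 for all v. -/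
theorem Bisection.mfderiv_rightAction_injective {g : G} (hg : g ∈ S.rightDomain) :
    Function.Injective
      (mfderiv 𝓘(ℝ, PhaseModel n) 𝓘(ℝ, PhaseModel n) S.rightAction g) := by
  rw [injective_iff_map_eq_zero]
  intro u hu
  refine 𝒢.symplectic.nondegenerate g u fun v => ?_
  have h := S.transformedForm_apply hg u v
  rw [S.mfderiv_src_eq_zero hg hu, Bisection.transformedForm, pullback_apply, hu,
    ← bilin_apply, ← bilin_apply (S.invariantFieldStrength (𝒢.src g)), map_zero, map_zero] at h
  simpa using h.symm

theorem Bisection.nondegenerate_transformedForm {g : G} (hg : g ∈ S.rightDomain) :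
    Nondegenerate (S.transformedForm g) := by
  have hinj := S.mfderiv_rightAction_injective hg
  have hsurj : Function.Surjective
      (mfderiv 𝓘(ℝ, PhaseModel n) 𝓘(ℝ, PhaseModel n) S.rightAction g) := by
    -- Both tangent spaces are the same finite-dimensional model space, so injectivity gives
    -- surjectivity.
    let L : PhaseModel n →ₗ[ℝ] PhaseModel n :=
      (mfderiv 𝓘(ℝ, PhaseModel n) 𝓘(ℝ, PhaseModel n) S.rightAction g).toLinearMap
    exact LinearMap.surjective_of_injective (f := L) hinj
  intro u hu
  refine (injective_iff_map_eq_zero _).1 hinj u (𝒢.symplectic.nondegenerate _ _ fun w => ?_)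
  obtain ⟨v, rfl⟩ := hsurj w
  rw [← hu v, Bisection.transformedForm, pullback_apply]

end Action

/-! ### Block matrices and their expansion in coordinates -/

section Blocks

variable {V : Type*} [AddCommGroup V] [Module ℝ V] [TopologicalSpace V] {n : ℕ}

/-- Split each vector into its y- and π-parts and expand bilinearly: the yy-term vanishes by
hypothesis, and the yπ-term is minus the πy-term by antisymmetry. -/
theorem hasBlocks_of_apply_eq_zero {B : V [⋀^Fin 2]→L[ℝ] ℝ}
    (e : V ≃ₗ[ℝ] (Fin n → ℝ) × (Fin n → ℝ))
    (h0 : ∀ p q, B ![e.symm (p, 0), e.symm (q, 0)] = 0) :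
    HasBlocks B e 0
      (Matrix.of fun m l => bilin B (e.symm (0, Pi.single m 1)) (e.symm (Pi.single l 1, 0)))
      (Matrix.of fun l m => bilin B (e.symm (0, Pi.single l 1)) (e.symm (0, Pi.single m 1))) := by
  let i₁ : (Fin n → ℝ) →ₗ[ℝ] V := e.symm.toLinearMap ∘ₗ LinearMap.inl ℝ _ _
  let i₂ : (Fin n → ℝ) →ₗ[ℝ] V := e.symm.toLinearMap ∘ₗ LinearMap.inr ℝ _ _
  intro u v
  have hdec : ∀ w, w = i₁ (e w).1 + i₂ (e w).2 := fun w => by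
    apply e.injective
    simp [i₁, i₂]
  have h1 : ∀ x y, _ = bilin B (i₂ x) (i₁ y) := dotProduct_of_mulVec (bilin B) (f := i₂) (g := i₁)
  have h2 : ∀ x y, _ = bilin B (i₂ x) (i₂ y) := dotProduct_of_mulVec (bilin B) (f := i₂) (g := i₂)
  have h3 : ∀ x y, bilin B (i₁ x) (i₁ y) = 0 := fun x y => h0 x y
  have h4 : bilin B (i₁ (e u).1) (i₂ (e v).2) = -bilin B (i₂ (e v).2) (i₁ (e u).1) :=
    apply_swap B _ _
  have hL : B ![u, v] = bilin B (i₂ (e u).2) (i₁ (e v).1)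
      - bilin B (i₂ (e v).2) (i₁ (e u).1) + bilin B (i₂ (e u).2) (i₂ (e v).2) := by
    rw [← bilin_apply]
    conv_lhs => rw [hdec u, hdec v]
    simp only [map_add, LinearMap.add_apply, h3, h4]
    ring
  rw [hL, ← h1, ← h1, ← h2, Matrix.zero_mulVec, dotProduct_zero, zero_add]
  rfl

theorem dotProduct_mulVec_of_antisymm {R : Matrix (Fin n) (Fin n) ℝ} (hR : Rᵀ = -R)
    (x y : Fin n → ℝ) :
    x ⬝ᵥ R *ᵥ y = 1 / 2 * ∑ l, ∑ m, R l m * (x l * y m - x m * y l) := by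
  have h1 : x ⬝ᵥ R *ᵥ y = ∑ l, ∑ m, R l m * (x l * y m) := by
    simp only [dotProduct, Matrix.mulVec, Finset.mul_sum]
    exact Finset.sum_congr rfl fun _ _ => Finset.sum_congr rfl fun _ _ => by ring
  have h2 : ∑ l, ∑ m, R l m * (x m * y l) = -∑ l, ∑ m, R l m * (x l * y m) := by
    rw [Finset.sum_comm, ← Finset.sum_neg_distrib]
    refine Finset.sum_congr rfl fun l _ => ?_
    rw [← Finset.sum_neg_distrib]
    refine Finset.sum_congr rfl fun m _ => ?_
    have : R m l = -R l m := congrFun (congrFun hR l) m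
    rw [this, neg_mul]
  simp only [mul_sub, Finset.sum_sub_distrib, h2, h1]
  ring

theorem dotProduct_mulVec_sub_eq_sum (Γ : Matrix (Fin n) (Fin n) ℝ) (x y p q : Fin n → ℝ) :
    p ⬝ᵥ Γ *ᵥ y - q ⬝ᵥ Γ *ᵥ x = ∑ l, ∑ m, Γ m l * (p m * y l - x l * q m) := by
  rw [Finset.sum_comm]
  simp only [dotProduct, Matrix.mulVec, Finset.mul_sum, ← Finset.sum_sub_distrib]
  exact Finset.sum_congr rfl fun _ _ => Finset.sum_congr rfl fun _ _ => by ring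

theorem transpose_of_bilin (B : V [⋀^Fin 2]→L[ℝ] ℝ) (f : Fin n → V) :
    (Matrix.of fun a b => B ![f a, f b])ᵀ = -Matrix.of fun a b => B ![f a, f b] := by
  ext a b
  exact apply_swap B _ _

end Blocks

/-! ### Cotangent coordinates and the blocks of ω and R_Σ^*ω -/

section Chart

/-- The differential of a chart of the maximal atlas, with values in the model space. -/
def chartDeriv {E M : Type*} [NormedAddCommGroup E] [NormedSpace ℝ E]
    [TopologicalSpace M] [ChartedSpace E M] {φ : OpenPartialHomeomorph M E}
    (hφ : φ ∈ IsManifold.maximalAtlas 𝓘(ℝ, E) ∞ M) {x : M} (hx : x ∈ φ.source) :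
    TangentSpace 𝓘(ℝ, E) x ≃L[ℝ] E :=
  ((mdifferentiable_of_mem_maximalAtlas hφ).mfderiv hx).trans
    (NormedSpace.fromTangentSpace (φ x))

theorem coe_chartDeriv {E M : Type*} [NormedAddCommGroup E] [NormedSpace ℝ E]
    [TopologicalSpace M] [ChartedSpace E M] {φ : OpenPartialHomeomorph M E}
    (hφ : φ ∈ IsManifold.maximalAtlas 𝓘(ℝ, E) ∞ M) {x : M} (hx : x ∈ φ.source) :
    (chartDeriv hφ hx : TangentSpace 𝓘(ℝ, E) x →L[ℝ] E) = mvfderiv 𝓘(ℝ, E) φ x := rfl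

theorem mvfderiv_clm_comp {E F F' M : Type*} [NormedAddCommGroup E] [NormedSpace ℝ E]
    [NormedAddCommGroup F] [NormedSpace ℝ F] [NormedAddCommGroup F'] [NormedSpace ℝ F']
    [TopologicalSpace M] [ChartedSpace E M] (L : F →L[ℝ] F') {f : M → F} {x : M}
    (hf : MDifferentiableAt 𝓘(ℝ, E) 𝓘(ℝ, F) f x) (u : TangentSpace 𝓘(ℝ, E) x) :
    mvfderiv 𝓘(ℝ, E) (fun y => L (f y)) x u = L (mvfderiv 𝓘(ℝ, E) f x u) := by
  have h := mfderiv_comp x (I'' := 𝓘(ℝ, F')) (g := L) L.differentiableAt.mdifferentiableAt hf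
  have h' := DFunLike.congr_fun h u
  refine h'.trans ?_
  change mfderiv 𝓘(ℝ, F) 𝓘(ℝ, F') L (f x) (mfderiv 𝓘(ℝ, E) 𝓘(ℝ, F) f x u) = _
  rw [mfderiv_eq_fderiv, L.fderiv]
  rfl

variable {n : ℕ} {G X : Type*} [TopologicalSpace G] [ChartedSpace (PhaseModel n) G]
  [TopologicalSpace X] [ChartedSpace (BaseModel n) X] {𝒢 : LocalSymplecticGroupoid n G X}
  (C : CotangentChart 𝒢)

/-- The coordinates `(dy, dπ)` on the tangent space. -/
def CotangentChart.coframe {g : G} (hg : g ∈ C.chart.source) :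
    TangentSpace 𝓘(ℝ, PhaseModel n) g ≃ₗ[ℝ] (Fin n → ℝ) × (Fin n → ℝ) :=
  (chartDeriv C.chart_mem hg).toLinearEquiv

variable {C} {g : G} (hg : g ∈ C.chart.source)
include hg

theorem CotangentChart.mdifferentiableAt_chart :
    MDifferentiableAt 𝓘(ℝ, PhaseModel n) 𝓘(ℝ, PhaseModel n) C.chart g :=
  (mdifferentiable_of_mem_maximalAtlas C.chart_mem).mdifferentiableAt hg

theorem CotangentChart.dy_apply (l : Fin n) (u : TangentSpace 𝓘(ℝ, PhaseModel n) g) :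
    C.dy l g u = (C.coframe hg u).1 l :=
  mvfderiv_clm_comp ((ContinuousLinearMap.proj l).comp (ContinuousLinearMap.fst ℝ _ _) :
    PhaseModel n →L[ℝ] ℝ)
    (C.mdifferentiableAt_chart hg) u

theorem CotangentChart.dπ_apply (m : Fin n) (u : TangentSpace 𝓘(ℝ, PhaseModel n) g) :
    C.dπ m g u = (C.coframe hg u).2 m :=
  mvfderiv_clm_comp ((ContinuousLinearMap.proj m).comp (ContinuousLinearMap.snd ℝ _ _) :
    PhaseModel n →L[ℝ] ℝ)
    (C.mdifferentiableAt_chart hg) u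

theorem CotangentChart.mfderiv_src_apply (u : TangentSpace 𝓘(ℝ, PhaseModel n) g) :
    mfderiv 𝓘(ℝ, PhaseModel n) 𝓘(ℝ, BaseModel n) 𝒢.src g u
      = (chartDeriv C.baseChart_mem (C.src_mem g hg)).symm (C.coframe hg u).1 := by
  rw [ContinuousLinearEquiv.eq_symm_apply]
  have h1 : mvfderiv 𝓘(ℝ, PhaseModel n) (fun h => (C.chart h).1) g u = (C.coframe hg u).1 :=
    mvfderiv_clm_comp (ContinuousLinearMap.fst ℝ _ _) (C.mdifferentiableAt_chart hg) u
  have hev : (fun h => (C.chart h).1) =ᶠ[𝓝 g] C.baseChart ∘ 𝒢.src := by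
    filter_upwards [C.chart.open_source.mem_nhds hg] with h hh using C.fst_eq h hh
  have h2 := mfderiv_comp g
    ((mdifferentiable_of_mem_maximalAtlas C.baseChart_mem).mdifferentiableAt (C.src_mem g hg))
    (𝒢.src_smooth.mdifferentiable (by simp) g)
  have h3 := DFunLike.congr_fun (hev.mfderiv_eq.trans h2) u
  rw [← h1]
  exact h3.symm

/-- Each term of dπ_μ ∧ dQ^μ carries a factor dπ_μ, so ω vanishes on pairs of vectors with dπ = 0,
whatever the functions Q are. -/
theorem CotangentChart.form_hasBlocks :
    ∃ Γ Ξ : Matrix (Fin n) (Fin n) ℝ, Ξᵀ = -Ξ ∧ HasBlocks (𝒢.form g) (C.coframe hg) 0 Γ Ξ := by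
  refine ⟨_, _, transpose_of_bilin _ _, hasBlocks_of_apply_eq_zero _ fun p q => ?_⟩
  rw [C.darboux g hg]
  refine Finset.sum_eq_zero fun μ _ => ?_
  have h : ∀ p, mvfderiv 𝓘(ℝ, PhaseModel n) (fun h => (C.chart h).2 μ) g
      ((C.coframe hg).symm (p, 0)) = 0 := fun p => by
    refine (C.dπ_apply hg μ _).trans ?_
    rw [LinearEquiv.apply_symm_apply]
    rfl
  rw [h, h]
  ring

variable (S : Bisection 𝒢)

/-- Since y is pulled back from the base, ds has the components dy in the base coordinates, so
s^*F^t involves dy alone. -/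
theorem CotangentChart.invariantFieldStrength_apply (u v : TangentSpace 𝓘(ℝ, PhaseModel n) g) :
    S.invariantFieldStrength (𝒢.src g)
        ![mfderiv 𝓘(ℝ, PhaseModel n) 𝓘(ℝ, BaseModel n) 𝒢.src g u,
          mfderiv 𝓘(ℝ, PhaseModel n) 𝓘(ℝ, BaseModel n) 𝒢.src g v]
      = (C.coframe hg u).1 ⬝ᵥ C.Ft S (𝒢.src g) *ᵥ (C.coframe hg v).1 := by
  rw [C.mfderiv_src_apply hg, C.mfderiv_src_apply hg, ← bilin_apply]
  refine (dotProduct_of_mulVec (bilin (S.invariantFieldStrength (𝒢.src g)))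
    (f := (chartDeriv C.baseChart_mem (C.src_mem g hg)).symm.toLinearMap)
    (g := (chartDeriv C.baseChart_mem (C.src_mem g hg)).symm.toLinearMap) _ _).symm.trans ?_
  have hb : ∀ a, (chartDeriv C.baseChart_mem (C.src_mem g hg)).symm (Pi.single a 1)
      = C.baseVector a (𝒢.src g) := fun a => by
    rw [CotangentChart.baseVector, ← coe_chartDeriv C.baseChart_mem (C.src_mem g hg),
      ContinuousLinearMap.inverse_equiv]
    rfl
  congr 2
  ext a b
  change S.invariantFieldStrength (𝒢.src g) ![(chartDeriv C.baseChart_mem (C.src_mem g hg)).symm _,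
    (chartDeriv C.baseChart_mem (C.src_mem g hg)).symm _] = _
  rw [hb, hb]
  rfl

variable [IsManifold 𝓘(ℝ, PhaseModel n) ∞ G]

theorem CotangentChart.transformedForm_hasBlocks (hgS : g ∈ S.rightDomain)
    {Γ Ξ : Matrix (Fin n) (Fin n) ℝ} (h : HasBlocks (𝒢.form g) (C.coframe hg) 0 Γ Ξ) :
    HasBlocks (S.transformedForm g) (C.coframe hg) (C.Ft S (𝒢.src g)) Γ Ξ := by
  intro u v
  rw [S.transformedForm_apply hgS, C.invariantFieldStrength_apply hg S, h u v, Matrix.zero_mulVec,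
    dotProduct_zero]
  ring

end Chart

end PoissonGauge

end

/-! ### The main theorem -/

theorem mainTheorem1 {n : ℕ} {G X : Type*}
    [TopologicalSpace G] [T2Space G] [ChartedSpace (PoissonGauge.PhaseModel n) G]
    [IsManifold 𝓘(ℝ, PoissonGauge.PhaseModel n) ∞ G]
    [TopologicalSpace X] [T2Space X] [ChartedSpace (PoissonGauge.BaseModel n) X]
    [IsManifold 𝓘(ℝ, PoissonGauge.BaseModel n) ∞ X]
    (Θ : PoissonGauge.PoissonTensor (PoissonGauge.BaseModel n) X)
    (𝒢 : PoissonGauge.LocalSymplecticGroupoid n G X) (hΘ : 𝒢.Integrates Θ)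
    (S : PoissonGauge.Bisection 𝒢) (C : PoissonGauge.CotangentChart 𝒢) :
    ∃ (R Γ Ξ : G → Matrix (Fin n) (Fin n) ℝ),
      -- block form of `R_Σ^*ω` in the coordinates `(y, π)`; `Γ g m l` is `Γ_l^m`
      (∀ g ∈ C.chart.source ∩ S.rightDomain,
        (R g)ᵀ = -R g ∧ (Ξ g)ᵀ = -Ξ g ∧ IsUnit (Γ g) ∧
        PoissonGauge.Nondegenerate (S.transformedForm g) ∧
        ∀ u v : TangentSpace 𝓘(ℝ, PoissonGauge.PhaseModel n) g,
          S.transformedForm g ![u, v] =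
            1 / 2 * ∑ l, ∑ m, R g l m *
              (C.dy l g u * C.dy m g v - C.dy m g u * C.dy l g v)
            + ∑ l, ∑ m, Γ g m l *
              (C.dπ m g u * C.dy l g v - C.dy l g u * C.dπ m g v)
            + 1 / 2 * ∑ l, ∑ m, Ξ g l m *
              (C.dπ l g u * C.dπ m g v - C.dπ m g u * C.dπ l g v)) ∧
      -- the field strengths on the zero section `π = 0`, at the base point `y = src g`
      (∀ g ∈ C.chart.source, (∀ m, C.π m g = 0) →
        let Fhat := C.momentumBrackets S g
        let Ft := C.Ft S (𝒢.src g)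
        let Ξhat := (Γ g)⁻¹ * Ξ g * ((Γ g)⁻¹)ᵀ
        g ∈ S.rightDomain ∧
        IsUnit (1 + ((Γ g)⁻¹)ᵀ * Ft * (Γ g)⁻¹ * Ξ g) ∧
        Fhat = (1 + ((Γ g)⁻¹)ᵀ * Ft * (Γ g)⁻¹ * Ξ g)⁻¹ * (((Γ g)⁻¹)ᵀ * Ft * (Γ g)⁻¹) ∧
        IsUnit (1 - (Γ g)ᵀ * Fhat * Γ g * Ξhat) ∧
        Ft = (1 - (Γ g)ᵀ * Fhat * Γ g * Ξhat)⁻¹ * ((Γ g)ᵀ * Fhat * Γ g)) := by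
  open PoissonGauge in
  -- The coframe exists only over the chart domain, so the blocks get the arbitrary value 0
  -- elsewhere to be functions on all of G.
  have hex : ∀ g, ∃ Γ Ξ : Matrix (Fin n) (Fin n) ℝ, ∀ hg : g ∈ C.chart.source,
      Ξᵀ = -Ξ ∧ HasBlocks (𝒢.form g) (C.coframe hg) 0 Γ Ξ := fun g => by
    by_cases hg : g ∈ C.chart.source
    · obtain ⟨Γ, Ξ, h⟩ := CotangentChart.form_hasBlocks hg
      exact ⟨Γ, Ξ, fun _ => h⟩
    · exact ⟨0, 0, fun h => absurd h hg⟩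
  choose Γ Ξ h using hex
  have hΓ : ∀ g ∈ C.chart.source, IsUnit (Γ g) := fun g hg =>
    (h g hg).2.isUnit_of_nondegenerate (𝒢.symplectic.nondegenerate g)
  -- The yy-block is F^t at the source point; Γ and Ξ are the blocks of ω itself and do not depend
  -- on Σ.
  refine ⟨fun g => C.Ft S (𝒢.src g), Γ, Ξ, ?_, ?_⟩
  · rintro g ⟨hg, hgS⟩
    have hR : (C.Ft S (𝒢.src g))ᵀ = -C.Ft S (𝒢.src g) := PoissonGauge.transpose_of_bilin _ _
    refine ⟨hR, (h g hg).1, hΓ g hg, S.nondegenerate_transformedForm hgS, fun u v => ?_⟩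
    simp only [C.dy_apply hg, C.dπ_apply hg]
    rw [C.transformedForm_hasBlocks hg S hgS (h g hg).2,
      ← PoissonGauge.dotProduct_mulVec_of_antisymm hR,
      ← PoissonGauge.dotProduct_mulVec_of_antisymm (h g hg).1,
      ← PoissonGauge.dotProduct_mulVec_sub_eq_sum]
    ring
  · intro g hg hπ
    -- A point with π = 0 is a unit, and a unit composes with the element of Σ whose target is its
    -- base point.
    have hgS : g ∈ S.rightDomain := by
      rw [(C.snd_eq_zero_iff g hg).1 (funext hπ)]
      exact S.unit_mem_rightDomain _
    have hB := C.transformedForm_hasBlocks hg S hgS (h g hg).2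
    have hN := S.nondegenerate_transformedForm hgS
    refine ⟨hgS, PoissonGauge.field_strength_relations (hΓ g hg)
      (hB.isUnit_one_add hN (hΓ g hg)) ?_⟩
    ext a b
    exact hB.inversePairing_snd hN (hΓ g hg) (C.dπ_apply hg a) (C.dπ_apply hg b)
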